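/- **Model.** Let $k\ge 1$. Agents $r_1,\dots,r_k$ with energies $e_1,\dots,e_k\ge 0$ are initially located at positions $0\le s_1\le s_2\le\cdots\le s_k\le 1$ of the segment $[0,1]$. Moving a distance $x$ costs an agent exactly $x$ units of its energy. When two different agents are at the same point, one of them, with current energy $e'$, may transfer any amount $0<x\le e'$ to the other. A *trajectory* of an agent is a finite walk in $[0,1]$ made of straight pieces, starting at its initial position, together with a schedule of energy transfers, i.e. the points of the walk at which it gives energy to or receives energy from a specified other agent, with the amounts. A set of trajectories (one for each of $r_1,\dots,r_k$) is *valid* if the moves and transfers can be ordered on a time line so that every transfer given by $r_i$ to $r_j$ is matched by the same transfer received by $r_j$ from $r_i$ while both are at the same point, every agent follows its whole trajectory, and no agent ever moves further, or gives more, than its current energy allows. It *explores* $[0,1]$ if every point of $[0,1]$ is visited by some agent. **Procedure.** Add a dummy agent $r_{k+1}$ with $s_{k+1}=1$, $e_{k+1}=0$. For $1\le i\le k$ the procedure $\mathrm{PATH}(i,\ell_i,tr_i)$ computes $\ell_{i+1}$ and $tr_{i+1}$ as follows. 1. If $tr_i\le 0$, let $d=s_i-\ell_i$. * (1.1) If $e_i<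 d+|tr_i|$, put $\ell_{i+1}=s_i$ and $tr_{i+1}=e_i+tr_i-d$. * (1.2) Otherwise let $e'=e_i-|tr_i|$ and $g=s_{i+1}-s_i$, and put $(y,L)=\bigl(\min\{\tfrac{e'-d}{2},g\},\,2y+d\bigr)$ if $e'\le 3d$; $(y,L)=(g,\,2y+d)$ if $e'>3d$ and $d\ge g$; $(y,L)=\bigl(\min\{e'-2d,g\},\,2d+y\bigr)$ if $e'>3d$ and $d<g$. Then $\ell_{i+1}=s_i+y$ and $tr_{i+1}=e_i+tr_i-L$. 2. If $tr_i>0$, let $y=\min\{s_{i+1}-s_i,\;e_i+tr_i\}$ and put $\ell_{i+1}=s_i+y$, $tr_{i+1}=tr_i+e_i-y$. If $i<k$, it then calls $\mathrm{PATH}(i+1,\ell_{i+1},tr_{i+1})$. If $i=k$, it returns **solvable** $=$ false when $\ell_{k+1}<1$ or $tr_{k+1}<0$, and **solvable** $=$ true otherwise. **Theorem.** There is an absolute constant $C$ such that for every $k\ge1$ and every such instance, the call $\mathrm{PATH}(1,0,0)$ terminates within $Ck$ steps (counting every arithmetic operation, constant, variable or array access, comparison, assignment, branching, call and return as one step, with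 exact real arithmetic), and it returns **solvable** $=$ true if and only if there is a valid set of trajectories of the agents $r_1,\dots,r_k$ that explores $[0,1]$. -/

import Mathlib

namespace SegmentExploration

/-! ### Agents, trajectories, validity, exploration -/

/-- One item of the trajectory of an agent: a straight move to the point `q`, or an item of its
schedule of energy transfers (hand the amount `x` to agent `j`, or get the amount `x` from agent
`j`), performed at the point of the walk that the agent has reached. -/
inductive Action (k : ℕ) : Type
  | move (q : ℝ)
  | give (j : Fin k) (x : ℝ)
  | receive (j : Fin k) (x : ℝ)

/-- A trajectory: a finite walk made of straight pieces, together with its schedule of energy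
transfers. The walk starts at the initial position of the agent. -/
abbrev Trajectory (k : ℕ) : Type := List (Action k)

/-- The points visited by an agent that starts at `p` and follows a trajectory. -/
def visited {k : ℕ} (p : ℝ) : Trajectory k → Set ℝ
  | [] => {p}
  | Action.move q :: t => Set.uIcc p q ∪ visited q t
  | Action.give _ _ :: t => visited p t
  | Action.receive _ _ :: t => visited p t

/-- Current positions, current energy levels, and the parts of the trajectories still to be
followed. -/
structure Config (k : ℕ) : Type where
  pos : Fin k → ℝ
  energy : Fin k → ℝ
  todo : Fin k → Trajectory k

/-- The next event on the time line. Either an agent performs the next straight move of its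
trajectory, inside `[0,1]`, for which its energy must suffice; or two distinct agents at the same
point perform a transfer that is the next item of both of their trajectories. Agents can stop and
wait, so only the order of the events on the time line matters. -/
inductive Step {k : ℕ} : Config k → Config k → Prop
  | move (c : Config k) (i : Fin k) (q : ℝ) (rest : Trajectory k)
      (htodo : c.todo i = Action.move q :: rest)
      (hq : q ∈ Set.Icc (0 : ℝ) 1)
      (henergy : |q - c.pos i| ≤ c.energy i) :
      Step c
        { pos := Function.update c.pos i q
          energy := Function.update c.energy i (c.energy i - |q - c.pos i|)
          todo := Function.update c.todo i rest }
  | transfer (c : Config k) (i j : Fin k) (x : ℝ) (resti restj : Trajectory k)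
      (hij : i ≠ j)
      (htodoi : c.todo i = Action.give j x :: resti)
      (htodoj : c.todo j = Action.receive i x :: restj)
      (hmeet : c.pos i = c.pos j)
      (hx : 0 < x)
      (henergy : x ≤ c.energy i) :
      Step c
        { pos := c.pos
          energy := Function.update (Function.update c.energy i (c.energy i - x)) j
            (c.energy j + x)
          todo := Function.update (Function.update c.todo i resti) j restj }

/-- A set of trajectories (one per agent) is valid for agents with initial positions `s` and
initial energies `e` if its moves and matching transfers can be put on a time line so that every
agent follows its trajectory to the end. -/
def Valid {k : ℕ} (s e : Fin k → ℝ) (T : Fin k → Trajectory k) : Prop :=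
  ∃ c : Config k, Relation.ReflTransGen Step ⟨s, e, T⟩ c ∧ ∀ i, c.todo i = []

/-- The trajectories explore the segment `[0,1]`. -/
def Explores {k : ℕ} (s : Fin k → ℝ) (T : Fin k → Trajectory k) : Prop :=
  Set.Icc (0 : ℝ) 1 ⊆ ⋃ i, visited (s i) (T i)

/-! ### A unit-cost language for tail-recursive procedures on real numbers

A procedure has an index parameter `i`, two real parameters (`l` and `tr`), and further local real
variables. It can read the entries `i` and `i + 1` of its input arrays. Every arithmetic operation,
constant, variable or array access, comparison, assignment, branching, call and return costs one
unit of time. -/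

/-- Real variables of the procedure. -/
inductive Var : Type
  | l | tr | nextL | nextTr | avail | d | g | y | len
  deriving DecidableEq

/-- Real-valued expressions; `energy` is `e_i`, `pos` is `s_i`, `posNext` is `s_{i+1}`. -/
inductive RealExpr : Type
  | const (n : ℕ)
  | var (v : Var)
  | energy
  | pos
  | posNext
  | add (a b : RealExpr)
  | sub (a b : RealExpr)
  | mul (a b : RealExpr)
  | div (a b : RealExpr)
  | min (a b : RealExpr)

/-- Tests; `idxLt` is the test `i < k`. -/
inductive Test : Type
  | le (a b : RealExpr)
  | lt (a b : RealExpr)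
  | or (p q : Test)
  | idxLt

/-- Commands; `call a b` is the tail call of the procedure itself with arguments `(i + 1, a, b)`,
and `ret r` returns the answer `r`. -/
inductive Cmd : Type
  | assign (v : Var) (a : RealExpr)
  | seq (c₁ c₂ : Cmd)
  | ite (p : Test) (c₁ c₂ : Cmd)
  | call (a b : RealExpr)
  | ret (r : Bool)

/-- The input: positions and energies of the agents `r_1, …, r_{k+1}`. -/
structure Input (k : ℕ) : Type where
  pos : Fin (k + 1) → ℝ
  energy : Fin (k + 1) → ℝ

/-- The entry number `j` (counted from `1`) of an array; entries out of range read as `0`. -/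
def entry {n : ℕ} (a : Fin n → ℝ) (j : ℕ) : ℝ :=
  if h : 1 ≤ j ∧ j ≤ n then a ⟨j - 1, by omega⟩ else 0

/-- The value of an expression during the invocation with index `i`. -/
noncomputable def RealExpr.eval {k : ℕ} (I : Input k) (i : ℕ) (σ : Var → ℝ) : RealExpr → ℝ
  | .const n => n
  | .var v => σ v
  | .energy => entry I.energy i
  | .pos => entry I.pos i
  | .posNext => entry I.pos (i + 1)
  | .add a b => a.eval I i σ + b.eval I i σ
  | .sub a b => a.eval I i σ - b.eval I i σ
  | .mul a b => a.eval I i σ * b.eval I i σ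
  | .div a b => a.eval I i σ / b.eval I i σ
  | .min a b => Min.min (a.eval I i σ) (b.eval I i σ)

/-- The time for evaluating an expression (`posNext` also computes the index `i + 1`). -/
def RealExpr.time : RealExpr → ℕ
  | .const _ => 1
  | .var _ => 1
  | .energy => 1
  | .pos => 1
  | .posNext => 2
  | .add a b => a.time + b.time + 1
  | .sub a b => a.time + b.time + 1
  | .mul a b => a.time + b.time + 1
  | .div a b => a.time + b.time + 1
  | .min a b => a.time + b.time + 1

/-- The truth value of a test. -/
def Test.Holds {k : ℕ} (I : Input k) (i : ℕ) (σ : Var → ℝ) : Test → Prop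
  | .le a b => a.eval I i σ ≤ b.eval I i σ
  | .lt a b => a.eval I i σ < b.eval I i σ
  | .or p q => p.Holds I i σ ∨ q.Holds I i σ
  | .idxLt => i < k

/-- The time for evaluating a test. -/
def Test.time : Test → ℕ
  | .le a b => a.time + b.time + 1
  | .lt a b => a.time + b.time + 1
  | .or p q => p.time + q.time + 1
  | .idxLt => 1

/-- How the execution of a command ends: it falls through with new values of the variables, or it
calls the procedure with real arguments `a`, `b`, or it returns an answer. -/
inductive Outcome : Type
  | next (σ : Var → ℝ)
  | call (a b : ℝ)
  | ret (r : Bool)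

open Classical in
/-- Execution of a command: the outcome and the time used. -/
noncomputable def Cmd.exec {k : ℕ} (I : Input k) (i : ℕ) : Cmd → (Var → ℝ) → Outcome × ℕ
  | .assign v a, σ => (.next (Function.update σ v (a.eval I i σ)), a.time + 1)
  | .seq c₁ c₂, σ =>
      match c₁.exec I i σ with
      | (.next σ', t) => ((c₂.exec I i σ').1, t + (c₂.exec I i σ').2)
      | (o, t) => (o, t)
  | .ite p c₁ c₂, σ =>
      if p.Holds I i σ then ((c₁.exec I i σ).1, p.time + 1 + (c₁.exec I i σ).2)
      else ((c₂.exec I i σ).1, p.time + 1 + (c₂.exec I i σ).2)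
  | .call a b, σ => (.call (a.eval I i σ) (b.eval I i σ), a.time + b.time + 2)
  | .ret r, _ => (.ret r, 1)

/-- The variables at the start of an invocation with real arguments `a`, `b`. -/
def initStore (a b : ℝ) : Var → ℝ
  | .l => a
  | .tr => b
  | _ => 0

/-- `Returns body I i a b r t`: the call with arguments `(i, a, b)` of the procedure with the given
body, on input `I`, terminates with answer `r` after exactly `t` units of time. -/
inductive Returns {k : ℕ} (body : Cmd) (I : Input k) : ℕ → ℝ → ℝ → Bool → ℕ → Prop
  | ret (i : ℕ) (a b : ℝ) (r : Bool) (t : ℕ)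
      (h : body.exec I i (initStore a b) = (.ret r, t)) :
      Returns body I i a b r t
  | call (i : ℕ) (a b a' b' : ℝ) (r : Bool) (t t' : ℕ)
      (h : body.exec I i (initStore a b) = (.call a' b', t))
      (h' : Returns body I (i + 1) a' b' r t') :
      Returns body I i a b r (t + t')

/-! ### The procedure `PATH(i, ℓ_i, tr_i)` -/

section Path

open RealExpr Var

/-- Case 1.1, `tr_i ≤ 0` and `e_i < s_i - ℓ_i + |tr_i|` (the deficit increases): agent `r_i` goes
from `s_i` to `ℓ_i`. -/
def deficitCase : Cmd :=
  .seq (.assign nextL pos)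
    (.assign nextTr (sub (add energy (var tr)) (sub pos (var l))))

/-- Case 1.2, `tr_i ≤ 0` and `e_i ≥ s_i - ℓ_i + |tr_i|` (the deficit is eliminated): with
`avail = e_i - |tr_i|`, `d = s_i - ℓ_i` and `g = s_{i+1} - s_i`, the trajectory of `r_i` covers
`[ℓ_i, s_i + y]` and has length `len`.
If `avail ≤ 3 d`, or else if `d ≥ g`, it goes from `s_i` right to `s_i + y` and back left to `ℓ_i`;
otherwise it goes from `s_i` left to `ℓ_i` and back right to `s_i + y`. -/
def balancedCase : Cmd :=
  .seq (.assign avail (add energy (var tr))) <|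
  .seq (.assign d (sub pos (var l))) <|
  .seq (.assign g (sub posNext pos)) <|
  .seq
    (.ite (.le (var avail) (mul (const 3) (var d)))
      (.seq (.assign y (min (div (sub (var avail) (var d)) (const 2)) (var g)))
        (.assign len (add (mul (const 2) (var y)) (var d))))
      (.ite (.le (var g) (var d))
        (.seq (.assign y (var g))
          (.assign len (add (mul (const 2) (var y)) (var d))))
        (.seq (.assign y (min (sub (var avail) (mul (const 2) (var d))) (var g)))
          (.assign len (add (mul (const 2) (var d)) (var y)))))) <|
  .seq (.assign nextTr (sub (add energy (var tr)) (var len)))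
    (.assign nextL (add pos (var y)))

/-- Case 2, `tr_i > 0` (energy surplus): agent `r_i` goes from `s_i` to the right until it runs out
of energy or reaches `s_{i+1}`. -/
def surplusCase : Cmd :=
  .seq (.assign y (min (sub posNext pos) (add energy (var tr)))) <|
  .seq (.assign nextL (add pos (var y)))
    (.assign nextTr (sub (add (var tr) energy) (var y)))

/-- The body of `PATH(i, ℓ_i, tr_i)`. -/
def pathBody : Cmd :=
  .seq
    (.ite (.le (var tr) (const 0))
      (.ite (.lt energy (sub (sub pos (var l)) (var tr))) deficitCase balancedCase)
      surplusCase)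
    (.ite .idxLt
      (.call (var nextL) (var nextTr))
      (.ite (.or (.lt (var nextL) (const 1)) (.lt (var nextTr) (const 0)))
        (.ret false)
        (.ret true)))

end Path

/-- The instance consisting of the agents `r_1, …, r_k` and a dummy agent `r_{k+1}` with zero energy
at position `1`. -/
def withDummy {k : ℕ} (s e : Fin k → ℝ) : Input k where
  pos := Fin.snoc (α := fun _ => ℝ) s 1
  energy := Fin.snoc (α := fun _ => ℝ) e 0

end SegmentExploration

/-! ### Energy balance and crossing counts of an arbitrary run. -/

namespace SegmentExploration

open MeasureTheory

/-! The value `tr` after `j` agents is the best energy balance at `l` once `[0,l]` has been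
explored: a surplus to hand on, or a debt that later agents must pay.

Necessity. For an arbitrary exploring run let `W x` be the distance travelled to the right of `x`.
It decreases at a rate equal to the number of crossings of `x`, and every point of `(0,1]` is
crossed (`Ledger.one_le_crossings`). Energy passes `x` only with a crossing agent, so a point
without rightward (leftward) crossings gives an upper (lower) bound on what is spent and left beyond
it. `Reach.travel_le` shows by induction on `j` that `W l`, plus the final energy beyond any `x >
l`, is at most `tr` plus the energy of the remaining agents. The hard case is an agent at `a` paying
a debt at `l < a` and still advancing by `y`. With `w = min y (a - l)`, either all of `(l,a)` or all
of `(a,a+w)` is crossed twice, which costs an extra `w`; or each interval has a point crossed at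
most once. Then the debt forces the left point to be crossed leftwards, `Ledger.no_right_crossing`
excludes rightward crossings of the other point, and the energy bound there suffices.

Sufficiency. The moves computed by the procedure are carried out recursively (`Reach.canServe`): an
agent settles the balance `tr` with its predecessors at `l` and the new balance with its successor
at the new frontier.

Linear time holds because the body has no loop and each call raises the index by one. -/

/-- The energy held by the agents at positions `≥ x`. -/
noncomputable def energyFrom {k : ℕ} (pos en : Fin k → ℝ) (x : ℝ) : ℝ :=
  ∑ i, if x ≤ pos i then en i else 0

theorem energyFrom_update {k : ℕ} (pos en : Fin k → ℝ) (i : Fin k) (q E x : ℝ) :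
    energyFrom (Function.update pos i q) (Function.update en i E) x =
      energyFrom pos en x + (if x ≤ q then E else 0) - (if x ≤ pos i then en i else 0) := by
  unfold energyFrom
  rw [← Finset.add_sum_erase _ _ (Finset.mem_univ i), ← Finset.add_sum_erase _ _ (Finset.mem_univ i)]
  have : ∀ j ∈ Finset.univ.erase i, (if x ≤ Function.update pos i q j
      then Function.update en i E j else 0) = if x ≤ pos j then en j else 0 := by
    intro j hj
    simp [Function.update_of_ne (Finset.ne_of_mem_erase hj)]
  rw [Finset.sum_congr rfl this]
  simp
  ring

theorem energyFrom_anti {k : ℕ} (pos en : Fin k → ℝ) (h : ∀ i, 0 ≤ en i) {x y : ℝ} (hxy : x ≤ y) :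
    energyFrom pos en y ≤ energyFrom pos en x := by
  refine Finset.sum_le_sum fun i _ => ?_
  have := h i
  split_ifs <;> linarith

theorem energyFrom_nonneg {k : ℕ} (pos en : Fin k → ℝ) (h : ∀ i, 0 ≤ en i) (x : ℝ) :
    0 ≤ energyFrom pos en x := by
  refine Finset.sum_nonneg fun i _ => ?_
  have := h i
  split_ifs <;> linarith

/-- The number of crossings of `x` to the right in a straight move from `a` to `b`. -/
noncomputable def crossR (a b x : ℝ) : ℕ := if a < x ∧ x ≤ b then 1 else 0

/-- The two sides of `x` are `(-∞, x)` and `[x, ∞)`, so reaching `x` from the left already counts as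
a crossing. -/
theorem crossR_add (a b x : ℝ) :
    crossR a b x + (if x ≤ a then 1 else 0) = crossR b a x + if x ≤ b then 1 else 0 := by
  unfold crossR
  split_ifs <;> grind

theorem crossR_add_eq_indicator (a b x : ℝ) :
    ((crossR a b x + crossR b a x : ℕ) : ℝ) =
      (Set.Ioc (min a b) (max a b)).indicator (fun _ => (1 : ℝ)) x := by
  unfold crossR
  simp only [Set.indicator, Set.mem_Ioc, min_lt_iff, le_max_iff]
  split_ifs <;> grind

theorem intervalIntegrable_crossR (a b p q : ℝ) :
    IntervalIntegrable (fun x => ((crossR a b x + crossR b a x : ℕ) : ℝ)) volume p q := by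
  simp only [crossR_add_eq_indicator]
  rw [intervalIntegrable_iff]
  exact (integrableOn_const (by simp)).indicator measurableSet_Ioc

/-- The map `max · p` projects onto `[p, ∞)`, so `|max b p - max a p|` is the length of the part of
the move to the right of `p`. -/
theorem integral_crossR (a b : ℝ) {p q : ℝ} (h : p ≤ q) :
    ∫ x in p..q, ((crossR a b x + crossR b a x : ℕ) : ℝ) =
      |max b p - max a p| - |max b q - max a q| := by
  simp only [crossR_add_eq_indicator]
  rw [intervalIntegral.integral_of_le h, setIntegral_indicator measurableSet_Ioc,
    Set.Ioc_inter_Ioc, setIntegral_const, Real.volume_real_Ioc]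
  simp only [smul_eq_mul, mul_one]
  rcases le_total a b with hab | hab <;> rcases le_total a p with h1 | h1 <;>
    rcases le_total b p with h2 | h2 <;> rcases le_total a q with h3 | h3 <;>
    rcases le_total b q with h4 | h4 <;>
    simp only [*, max_eq_left, max_eq_right, min_eq_left, min_eq_right] <;>
    grind

/-- The crossings of every point `x` to the right (`R`) and to the left (`L`) by every agent, and
the total distance `W x` travelled to the right of `x`, between two configurations. -/
structure Ledger {k : ℕ} (c c' : Config k) (R L : Fin k → ℝ → ℕ) (W : ℝ → ℝ) : Prop where
  side : ∀ i x, R i x + (if x ≤ c.pos i then 1 else 0) = L i x + if x ≤ c'.pos i then 1 else 0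
  flux_nonpos : ∀ x, (∀ i, R i x = 0) →
    energyFrom c'.pos c'.energy x + W x ≤ energyFrom c.pos c.energy x
  flux_nonneg : ∀ x, (∀ i, L i x = 0) →
    energyFrom c.pos c.energy x ≤ energyFrom c'.pos c'.energy x + W x
  integrable : ∀ p q, IntervalIntegrable (fun x => ((∑ i, (R i x + L i x) : ℕ) : ℝ)) volume p q
  integral : ∀ p q, p ≤ q → ∫ x in p..q, ((∑ i, (R i x + L i x) : ℕ) : ℝ) = W p - W q
  travel_nonneg : ∀ x, 0 ≤ W x
  right_zero : (∀ i, 0 ≤ c.pos i) → ∀ i, R i 0 = 0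
  energy_nonneg : (∀ i, 0 ≤ c.energy i) → ∀ i, 0 ≤ c'.energy i
  visited_side : (∀ i, c'.todo i = []) → ∀ i x, R i x = 0 → L i x = 0 →
    (x ≤ c.pos i ∧ visited (c.pos i) (c.todo i) ⊆ Set.Ici x) ∨
      (c.pos i < x ∧ visited (c.pos i) (c.todo i) ⊆ Set.Iio x)

theorem Ledger.refl {k : ℕ} (c : Config k) :
    Ledger c c (fun _ _ => 0) (fun _ _ => 0) (fun _ => 0) where
  side := by simp
  flux_nonpos := by simp
  flux_nonneg := by simp
  integrable := by simp
  integral := by simp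
  travel_nonneg := by simp
  right_zero := by simp
  energy_nonneg := fun h => h
  visited_side := by
    intro h i x _ _
    rw [h i]
    simpa [visited] using le_or_gt x (c.pos i)

theorem sum_update_add {k : ℕ} (R L : Fin k → ℝ → ℕ) (i : Fin k) (r l : ℝ → ℕ) (x : ℝ) :
    ∑ j, ((if j = i then R j x + r x else R j x) + if j = i then L j x + l x else L j x) =
      ∑ j, (R j x + L j x) + (r x + l x) := by
  rw [← Finset.add_sum_erase _ _ (Finset.mem_univ i), ← Finset.add_sum_erase _ _ (Finset.mem_univ i)]
  have : ∀ j ∈ Finset.univ.erase i, ((if j = i then R j x + r x else R j x) +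
      if j = i then L j x + l x else L j x) = R j x + L j x := by
    intro j hj
    simp [Finset.ne_of_mem_erase hj]
  rw [Finset.sum_congr rfl this]
  simp
  ring

/-- Events are prepended, because `visited` unfolds a trajectory from its head. -/
theorem Ledger.head_move {k : ℕ} {c c' : Config k} (i : Fin k) (q : ℝ) (rest : Trajectory k)
    (htodo : c.todo i = Action.move q :: rest) (hq : q ∈ Set.Icc (0 : ℝ) 1)
    (henergy : |q - c.pos i| ≤ c.energy i) {R L : Fin k → ℝ → ℕ} {W : ℝ → ℝ}
    (h : Ledger
        { pos := Function.update c.pos i q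
          energy := Function.update c.energy i (c.energy i - |q - c.pos i|)
          todo := Function.update c.todo i rest } c' R L W) :
    Ledger c c' (fun j x => if j = i then R j x + crossR (c.pos i) q x else R j x)
      (fun j x => if j = i then L j x + crossR q (c.pos i) x else L j x)
      (fun x => W x + |max q x - max (c.pos i) x|) where
  side := by
    intro j x
    have h1 := h.side j x
    by_cases hj : j = i
    · subst hj
      have h2 := crossR_add (c.pos j) q x
      simp only [if_true, Function.update_self] at h1 ⊢
      omega
    · simpa [hj, Function.update_of_ne hj] using h1
  flux_nonpos := by
    intro x hx
    have h1 := h.flux_nonpos x fun j => by have := hx j; split_ifs at this <;> omega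
    have h2 := hx i
    simp only [if_true, Nat.add_eq_zero_iff, crossR] at h2
    dsimp only at h1 ⊢
    rw [energyFrom_update] at h1
    have h3 : ¬ (c.pos i < x ∧ x ≤ q) := by have := h2.2; split_ifs at this; assumption
    -- A move inside `[x, ∞)` keeps energy plus travel constant. A move that leaves it spends there
    -- at most the energy of the agent.
    have : (if x ≤ q then c.energy i - |q - c.pos i| else 0) + |max q x - max (c.pos i) x| ≤
        if x ≤ c.pos i then c.energy i else 0 := by
      split_ifs <;> grind
    linarith
  flux_nonneg := by
    intro x hx
    have h1 := h.flux_nonneg x fun j => by have := hx j; split_ifs at this <;> omega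
    have h2 := hx i
    simp only [if_true, Nat.add_eq_zero_iff, crossR] at h2
    dsimp only at h1 ⊢
    rw [energyFrom_update] at h1
    have h3 : ¬ (q < x ∧ x ≤ c.pos i) := by have := h2.2; split_ifs at this; assumption
    have : (if x ≤ c.pos i then c.energy i else 0) ≤
        (if x ≤ q then c.energy i - |q - c.pos i| else 0) + |max q x - max (c.pos i) x| := by
      split_ifs <;> grind
    linarith
  integrable := by
    intro a b
    simp only [sum_update_add]
    simp only [Nat.cast_add _ (_ + _)]
    exact (h.integrable a b).add (intervalIntegrable_crossR _ _ a b)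
  integral := by
    intro a b hab
    simp only [sum_update_add]
    simp only [Nat.cast_add _ (_ + _)]
    rw [intervalIntegral.integral_add (h.integrable a b) (intervalIntegrable_crossR _ _ a b),
      h.integral a b hab, integral_crossR _ _ hab]
    ring
  travel_nonneg := fun x => add_nonneg (h.travel_nonneg x) (abs_nonneg _)
  right_zero := by
    intro h0 j
    have h1 : R j 0 = 0 := h.right_zero (fun l => by
      by_cases hl : l = i
      · subst hl; simpa using hq.1
      · simpa [Function.update_of_ne hl] using h0 l) j
    have h2 : ¬ (c.pos i < 0) := not_lt.2 (h0 i)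
    simp [h1, crossR, h2]
  energy_nonneg := by
    intro h0
    refine h.energy_nonneg fun l => ?_
    by_cases hl : l = i
    · subst hl; simpa using henergy
    · simpa [Function.update_of_ne hl] using h0 l
  visited_side := by
    intro h0 j x hR hL
    by_cases hj : j = i
    · subst hj
      simp only [if_true, Nat.add_eq_zero_iff] at hR hL
      have h1 := h.visited_side h0 j x hR.1 hL.1
      simp only [Function.update_self] at h1
      have h2 : ¬ (c.pos j < x ∧ x ≤ q) := by
        have := hR.2; unfold crossR at this; split_ifs at this; assumption
      have h3 : ¬ (q < x ∧ x ≤ c.pos j) := by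
        have := hL.2; unfold crossR at this; split_ifs at this; assumption
      rw [htodo, visited]
      rcases h1 with ⟨h1, h4⟩ | ⟨h1, h4⟩
      · have h5 : x ≤ c.pos j := by grind
        refine Or.inl ⟨h5, Set.union_subset (fun z hz => ?_) h4⟩
        rw [Set.mem_uIcc] at hz
        simp only [Set.mem_Ici]
        grind
      · have h5 : c.pos j < x := by grind
        refine Or.inr ⟨h5, Set.union_subset (fun z hz => ?_) h4⟩
        rw [Set.mem_uIcc] at hz
        simp only [Set.mem_Iio]
        grind
    · simp only [hj, if_false] at hR hL
      simpa [Function.update_of_ne hj] using h.visited_side h0 j x hR hL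

/-- Two agents that meet are on the same side of every `x`. -/
theorem energyFrom_transfer {k : ℕ} (pos en : Fin k → ℝ) {i j : Fin k} (hij : i ≠ j)
    (h : pos i = pos j) (x z : ℝ) :
    energyFrom pos (Function.update (Function.update en i (en i - z)) j (en j + z)) x =
      energyFrom pos en x := by
  have h1 := energyFrom_update pos (Function.update en i (en i - z)) j (pos j) (en j + z) x
  have h2 := energyFrom_update pos en i (pos i) (en i - z) x
  rw [Function.update_eq_self] at h1 h2
  rw [h1, h2, Function.update_of_ne hij.symm, h]
  split_ifs <;> ring

theorem Ledger.head_transfer {k : ℕ} {c c' : Config k} (i j : Fin k) (z : ℝ)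
    (resti restj : Trajectory k) (hij : i ≠ j)
    (htodoi : c.todo i = Action.give j z :: resti)
    (htodoj : c.todo j = Action.receive i z :: restj)
    (hmeet : c.pos i = c.pos j) (hz : 0 < z) (henergy : z ≤ c.energy i)
    {R L : Fin k → ℝ → ℕ} {W : ℝ → ℝ}
    (h : Ledger
        { pos := c.pos
          energy := Function.update (Function.update c.energy i (c.energy i - z)) j
            (c.energy j + z)
          todo := Function.update (Function.update c.todo i resti) j restj } c' R L W) :
    Ledger c c' R L W where
  side := h.side
  flux_nonpos := fun x hx => by
    have := h.flux_nonpos x hx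
    rwa [energyFrom_transfer _ _ hij hmeet] at this
  flux_nonneg := fun x hx => by
    have := h.flux_nonneg x hx
    rwa [energyFrom_transfer _ _ hij hmeet] at this
  integrable := h.integrable
  integral := h.integral
  travel_nonneg := h.travel_nonneg
  right_zero := h.right_zero
  energy_nonneg := fun h0 => h.energy_nonneg fun l => by
    have := h0 l
    dsimp only
    by_cases hl : l = j
    · subst hl
      rw [Function.update_self]
      linarith
    · rw [Function.update_of_ne hl]
      by_cases hl : l = i
      · subst hl
        rw [Function.update_self]
        linarith
      · rwa [Function.update_of_ne hl]
  visited_side := fun h0 l x hR hL => by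
    have h1 := h.visited_side h0 l x hR hL
    dsimp only at h1
    by_cases hl : l = j
    · subst hl
      rw [Function.update_self] at h1
      rwa [htodoj, visited]
    · rw [Function.update_of_ne hl] at h1
      by_cases hl : l = i
      · subst hl
        rw [Function.update_self] at h1
        rwa [htodoi, visited]
      · rwa [Function.update_of_ne hl] at h1

theorem exists_ledger {k : ℕ} {c c' : Config k} (h : Relation.ReflTransGen Step c c') :
    ∃ R L W, Ledger c c' R L W := by
  induction h using Relation.ReflTransGen.head_induction_on with
  | refl => exact ⟨_, _, _, Ledger.refl c'⟩
  | head h1 _ ih =>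
    obtain ⟨R, L, W, ih⟩ := ih
    cases h1 with
    | move i q rest h2 h3 h4 => exact ⟨_, _, _, ih.head_move i q rest h2 h3 h4⟩
    | transfer i j x ri rj h1 h2 h3 h4 h5 h6 =>
      exact ⟨_, _, _, ih.head_transfer i j x ri rj h1 h2 h3 h4 h5 h6⟩

/-! ### Lower bounds on travel from crossing counts. -/

theorem Ledger.mul_le_travel {k : ℕ} {c c' : Config k} {R L : Fin k → ℝ → ℕ} {W : ℝ → ℝ}
    (h : Ledger c c' R L W) (m : ℕ) {p q : ℝ} (hpq : p ≤ q)
    (hm : ∀ x, p < x → x < q → m ≤ ∑ i, (R i x + L i x)) : m * (q - p) ≤ W p - W q := by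
  rw [← h.integral p q hpq]
  have := intervalIntegral.integral_mono_on_of_le_Ioo (μ := volume) (a := p) (b := q) hpq
    (f := fun _ => (m : ℝ)) (by simp) (h.integrable p q)
    fun x hx => Nat.cast_le.2 (hm x hx.1 hx.2)
  simpa [mul_comm] using this

/-- In an exploring run every point of `(0,1]` is crossed. -/
theorem Ledger.one_le_crossings {k : ℕ} {c c' : Config k} {R L : Fin k → ℝ → ℕ} {W : ℝ → ℝ}
    (h : Ledger c c' R L W) (htodo : ∀ i, c'.todo i = [])
    (hexp : Explores c.pos c.todo) {x : ℝ} (hx : 0 < x) (hx1 : x ≤ 1) :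
    1 ≤ ∑ i, (R i x + L i x) := by
  by_contra! h0
  have h0 : ∀ i, R i x = 0 ∧ L i x = 0 := by
    intro i
    have := (Finset.sum_eq_zero_iff.1 (Nat.lt_one_iff.1 h0)) i (Finset.mem_univ i)
    omega
  have hv := fun i => h.visited_side htodo i x (h0 i).1 (h0 i).2
  have hclosed : ∀ (t : Trajectory k) (p : ℝ), IsClosed (visited p t) := by
    intro t
    induction t with
    | nil => intro p; simp [visited]
    | cons a t ih =>
      intro p
      cases a with
      | move q => exact isClosed_Icc.union (ih q)
      | give _ _ => exact ih p
      | receive _ _ => exact ih p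
  -- If `x` is not crossed, the agents starting below `x` must visit all of `(0,x)`. Finitely many
  -- closed sets then also contain the limit point `x`.
  have hU : IsClosed (⋃ i ∈ {i | c.pos i < x}, visited (c.pos i) (c.todo i)) :=
    (Set.toFinite _).isClosed_biUnion fun i _ => hclosed _ _
  have hsub : Set.Ioo 0 x ⊆ ⋃ i ∈ {i | c.pos i < x}, visited (c.pos i) (c.todo i) := by
    intro z hz
    obtain ⟨i, hi⟩ := Set.mem_iUnion.1 (hexp ⟨hz.1.le, hz.2.le.trans hx1⟩)
    refine Set.mem_biUnion (x := i) ?_ hi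
    rcases hv i with ⟨_, h2⟩ | ⟨h1, _⟩
    · exact absurd (h2 hi) (not_le.2 hz.2)
    · exact h1
  have hmem := hU.closure_subset_iff.2 hsub
    (by rw [closure_Ioo hx.ne]; exact ⟨hx.le, le_rfl⟩ : x ∈ closure (Set.Ioo 0 x))
  obtain ⟨i, hi, hmem⟩ := Set.mem_iUnion₂.1 hmem
  rcases hv i with ⟨h1, _⟩ | ⟨_, h2⟩
  · exact absurd hi (not_lt.2 h1)
  · exact lt_irrefl x (h2 hmem)

end SegmentExploration

namespace SegmentExploration

/-! ### The states reached by the procedure -/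

/-- The effect `(l, tr) ↦ (l', tr')` of one invocation of the procedure for an agent at `s` with
energy `e`, the next agent being at `s'`. -/
inductive Advance (e s s' l tr : ℝ) : ℝ → ℝ → Prop
  | deficit (htr : tr ≤ 0) (he : e < s - l - tr) : Advance e s s' l tr s (e + tr - (s - l))
  | rightFirst (y : ℝ) (htr : tr ≤ 0) (h0 : 0 ≤ y) (hd : y ≤ s - l) (hg : y ≤ s' - s)
      (he : 2 * y ≤ e + tr - (s - l)) (hmax : y = s' - s ∨ 2 * y = e + tr - (s - l)) :
      Advance e s s' l tr (s + y) (e + tr - (2 * y + (s - l)))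
  | leftFirst (y : ℝ) (htr : tr ≤ 0) (hd : s - l ≤ y) (hg : y ≤ s' - s)
      (hd3 : 3 * (s - l) ≤ e + tr) (he : y ≤ e + tr - 2 * (s - l))
      (hmax : y = s' - s ∨ y = e + tr - 2 * (s - l)) :
      Advance e s s' l tr (s + y) (e + tr - (2 * (s - l) + y))
  | surplus (y : ℝ) (htr : 0 < tr) (h0 : 0 ≤ y) (hg : y ≤ s' - s) (he : y ≤ e + tr)
      (hmax : y = s' - s ∨ y = e + tr) :
      Advance e s s' l tr (s + y) (tr + e - y)

/-- The position of the agent number `j` (counted from `0`), with a dummy agent at `1`. -/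
noncomputable def station {k : ℕ} (s : Fin k → ℝ) (j : ℕ) : ℝ := if h : j < k then s ⟨j, h⟩ else 1

theorem station_of_lt {k : ℕ} (s : Fin k → ℝ) {j : ℕ} (h : j < k) : station s j = s ⟨j, h⟩ :=
  dif_pos h

theorem station_of_le {k : ℕ} (s : Fin k → ℝ) {j : ℕ} (h : k ≤ j) : station s j = 1 :=
  dif_neg (not_lt.2 h)

theorem station_mem {k : ℕ} {s : Fin k → ℝ} (hs : ∀ i, s i ∈ Set.Icc (0 : ℝ) 1) (j : ℕ) :
    station s j ∈ Set.Icc (0 : ℝ) 1 := by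
  unfold station
  split_ifs
  · exact hs _
  · simp

theorem station_mono {k : ℕ} {s : Fin k → ℝ} (hmono : Monotone s)
    (hs : ∀ i, s i ∈ Set.Icc (0 : ℝ) 1) : Monotone (station s) := by
  intro a b hab
  by_cases hb : b < k
  · rw [station_of_lt s hb, station_of_lt s (hab.trans_lt hb)]
    exact hmono hab
  · rw [station_of_le s (not_lt.1 hb)]
    exact (station_mem hs a).2

/-- `Reach s e j l tr`: after the invocations for the first `j` agents the values are `l`, `tr`. -/
inductive Reach {k : ℕ} (s e : Fin k → ℝ) : ℕ → ℝ → ℝ → Prop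
  | zero : Reach s e 0 0 0
  | succ {j : ℕ} {l tr l' tr' : ℝ} (h : Reach s e j l tr) (hj : j < k)
      (ha : Advance (e ⟨j, hj⟩) (station s j) (station s (j + 1)) l tr l' tr') :
      Reach s e (j + 1) l' tr'

/-- The maximality of `y` in `Advance` ensures that energy is left over only if the next agent has
been reached. -/
theorem Reach.invariant {k : ℕ} {s e : Fin k → ℝ} (hmono : Monotone s)
    (hs : ∀ i, s i ∈ Set.Icc (0 : ℝ) 1) {j : ℕ} {l tr : ℝ} (h : Reach s e j l tr) :
    0 ≤ l ∧ l ≤ station s j ∧ (0 < tr → l = station s j) ∧ ∀ i, i < j → station s i ≤ l := by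
  induction h with
  | zero => exact ⟨le_rfl, (station_mem hs 0).1, fun h => absurd h (lt_irrefl _), by simp⟩
  | @succ j l tr l' tr' h hj ha ih =>
    obtain ⟨h0, h1, h2, h3⟩ := ih
    have h4 : station s j ≤ station s (j + 1) := station_mono hmono hs (Nat.le_succ j)
    have h5 : 0 ≤ station s j := (station_mem hs j).1
    have key : station s j ≤ l' ∧ l' ≤ station s (j + 1) ∧ (0 < tr' → l' = station s (j + 1)) := by
      cases ha with
      | deficit => exact ⟨le_rfl, h4, fun h => by linarith⟩
      | rightFirst y htr h0 hd hg he hmax =>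
        refine ⟨by linarith, by linarith, fun h => ?_⟩
        rcases hmax with h | h <;> linarith
      | leftFirst y htr hd hg hd3 he hmax =>
        refine ⟨by linarith, by linarith, fun h => ?_⟩
        rcases hmax with h | h <;> linarith
      | surplus y htr h0 hg he hmax =>
        refine ⟨by linarith, by linarith, fun h => ?_⟩
        rcases hmax with h | h <;> linarith
    exact ⟨h5.trans key.1, key.2.1, key.2.2, fun i hi =>
      (station_mono hmono hs (Nat.lt_succ_iff.1 hi)).trans key.1⟩

/-! ### Necessity -/

theorem energyFrom_eq_sum_le {k : ℕ} {s e : Fin k → ℝ} {j : ℕ} {x : ℝ}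
    (hlt : ∀ i : Fin k, i.1 < j → s i < x) (hle : ∀ i : Fin k, j ≤ i.1 → x ≤ s i) :
    energyFrom s e x = ∑ i, if j ≤ i.1 then e i else 0 := by
  refine Finset.sum_congr rfl fun i _ => ?_
  by_cases h : j ≤ i.1
  · rw [if_pos h, if_pos (hle i h)]
  · rw [if_neg h, if_neg (not_le.2 (hlt i (not_le.1 h)))]

theorem sum_tail_succ {k : ℕ} (e : Fin k → ℝ) {j : ℕ} (hj : j < k) :
    (∑ i : Fin k, if j ≤ i.1 then e i else 0) =
      e ⟨j, hj⟩ + ∑ i : Fin k, if j + 1 ≤ i.1 then e i else 0 := by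
  rw [← Finset.add_sum_erase _ _ (Finset.mem_univ (⟨j, hj⟩ : Fin k)),
    ← Finset.add_sum_erase Finset.univ (fun i : Fin k => if j + 1 ≤ i.1 then e i else 0)
      (Finset.mem_univ (⟨j, hj⟩ : Fin k))]
  have : ∀ i ∈ Finset.univ.erase (⟨j, hj⟩ : Fin k), (if j ≤ i.1 then e i else 0) =
      if j + 1 ≤ i.1 then e i else 0 := by
    intro i hi
    have : i.1 ≠ j := fun h => Finset.ne_of_mem_erase hi (Fin.ext h)
    exact if_congr (by omega) rfl rfl
  rw [Finset.sum_congr rfl this]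
  simp

/-- If `x` left of agent `j` is crossed once, to the left, and `x'` right of agent `j` at most
once, then `x'` is not crossed to the right. -/
theorem Ledger.no_right_crossing {k : ℕ} {c c' : Config k} {R L : Fin k → ℝ → ℕ} {W : ℝ → ℝ}
    (h : Ledger c c' R L W) {j : ℕ} {x x' : ℝ} (hxx : x < x')
    (hlt : ∀ i : Fin k, i.1 < j → c.pos i < x) (hle : ∀ i : Fin k, j < i.1 → x' ≤ c.pos i)
    (hx : ∑ i, (R i x + L i x) ≤ 1) (hL : ∃ i, L i x ≠ 0)
    (hx' : ∑ i, (R i x' + L i x') ≤ 1) : ∀ i, R i x' = 0 := by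
  by_contra! hR
  obtain ⟨a, ha⟩ := hL
  obtain ⟨b, hb⟩ := hR
  have hother : ∀ {z : ℝ}, ∑ i, (R i z + L i z) ≤ 1 → ∀ p q : Fin k, p ≠ q →
      (R p z + L p z) + (R q z + L q z) ≤ 1 := by
    intro z hz p q hpq
    rw [← Finset.sum_pair hpq (f := fun i => R i z + L i z)]
    exact (Finset.sum_le_sum_of_subset (Finset.subset_univ _)).trans hz
  have hsingle : ∀ {z : ℝ}, ∑ i, (R i z + L i z) ≤ 1 → ∀ p : Fin k, R p z + L p z ≤ 1 :=
    fun hz p => (Finset.single_le_sum (f := fun i => R i _ + L i _)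
      (fun _ _ => Nat.zero_le _) (Finset.mem_univ p)).trans hz
  have ha1 := hsingle hx a
  have hb1 := hsingle hx' b
  have ha2 := h.side a x
  have hb2 := h.side b x'
  have hasta : x ≤ c.pos a ∧ c'.pos a < x := by
    split_ifs at ha2 <;> first | omega | (constructor <;> linarith)
  have hbstb : c.pos b < x' ∧ x' ≤ c'.pos b := by
    split_ifs at hb2 <;> first | omega | (constructor <;> linarith)
  have hab : a ≠ b := by
    rintro rfl
    linarith [hasta.2, hbstb.2]
  have hbx := h.side b x
  have h1 := hother hx a b hab
  -- The only crossing of `x` belongs to `a`. So `b`, which ends beyond `x`, also starts there,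
  -- which leaves only the agent number `j`.
  have hbx : x ≤ c.pos b := by
    have : x ≤ c'.pos b := by linarith [hbstb.2]
    rw [if_pos this] at hbx
    split_ifs at hbx
    · assumption
    · omega
  have hbj : b.1 = j := by
    by_contra hne
    rcases Nat.lt_or_gt_of_ne hne with h2 | h2
    · linarith [hlt b h2]
    · linarith [hle b h2, hbstb.1]
  have haj : j < a.1 := by
    by_contra hne
    rcases Nat.lt_or_eq_of_le (not_lt.1 hne) with h2 | h2
    · linarith [hlt a h2]
    · exact hab (Fin.ext (by omega))
  have h2 := h.side a x'
  rw [if_pos (hle a haj), if_neg (by linarith [hasta.2])] at h2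
  have h3 := hother hx' a b hab
  omega

/-- The final energy beyond `x` is part of the bound because the lower bound from `flux_nonneg` is
on travel and leftover energy together. -/
theorem Reach.travel_le {k : ℕ} {s e : Fin k → ℝ} (hmono : Monotone s)
    (hs : ∀ i, s i ∈ Set.Icc (0 : ℝ) 1) (he : ∀ i, 0 ≤ e i) {T : Fin k → Trajectory k}
    {c' : Config k} {R L : Fin k → ℝ → ℕ} {W : ℝ → ℝ} (hled : Ledger ⟨s, e, T⟩ c' R L W)
    (htodo : ∀ i, c'.todo i = []) (hexp : Explores s T)
    {j : ℕ} {l tr : ℝ} (h : Reach s e j l tr) : ∀ x, l < x →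
    W l + energyFrom c'.pos c'.energy x ≤ tr + ∑ i, if j ≤ i.1 then e i else 0 := by
  have hres := hled.energy_nonneg he
  have hone : ∀ {p q : ℝ}, 0 ≤ p → p ≤ q → q ≤ 1 → q - p ≤ W p - W q := by
    intro p q h0 hpq h1
    have := hled.mul_le_travel 1 hpq fun x hx hx' =>
      hled.one_le_crossings htodo hexp (by linarith) (by linarith)
    simpa using this
  induction h with
  | zero =>
    intro x hx
    have h1 := hled.flux_nonpos 0 (hled.right_zero fun i => (hs i).1)
    have h2 := energyFrom_anti c'.pos c'.energy hres hx.le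
    rw [energyFrom_eq_sum_le (j := 0) (by simp) (fun i _ => (hs i).1)] at h1
    linarith
  | @succ j l tr l' tr' h hj ha ih =>
    obtain ⟨hl0, hl1, hl2, hl3⟩ := h.invariant hmono hs
    have hs0 := (station_mem hs j).1
    have hs1 := (station_mem hs (j + 1)).2
    have hs2 : station s j ≤ station s (j + 1) := station_mono hmono hs (Nat.le_succ j)
    rw [sum_tail_succ e hj] at ih
    set E : ℝ := ∑ i : Fin k, if j + 1 ≤ i.1 then e i else 0 with hE
    set a := station s j with ha_def
    set H := energyFrom c'.pos c'.energy with hH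
    have hlt : ∀ {x : ℝ}, l < x → ∀ i : Fin k, i.1 < j → s i < x := fun hx i hi => by
      have := hl3 i hi
      rw [station_of_lt s i.2] at this
      exact this.trans_lt hx
    have hle : ∀ {x : ℝ} {m : ℕ}, x ≤ station s m → ∀ i : Fin k, m ≤ i.1 → x ≤ s i :=
      fun hx i hi => by
        have := station_mono hmono hs hi
        rw [station_of_lt s i.2] at this
        exact hx.trans this
    have hla : a - l ≤ W l - W a := hone hl0 hl1 (by linarith)
    -- in the balanced case, the sweep of width `w = min y (a - l)` is paid for twice
    have balanced : ∀ y w : ℝ, tr ≤ 0 → 0 ≤ w → w ≤ y → w ≤ a - l → y ≤ station s (j + 1) - a →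
        2 * w ≤ e ⟨j, hj⟩ + tr - (a - l) → ∀ x, a + y < x →
        W (a + y) + H x ≤ e ⟨j, hj⟩ + tr - (a - l) - y - w + E := by
      intro y w htr hw0 hwy hwd hyg hw2 x hx
      have hay : y ≤ W a - W (a + y) := by
        have := hone (p := a) (q := a + y) hs0 (by linarith) (by linarith)
        linarith
      have ihx := ih x (by linarith)
      by_cases hA : ∀ z, l < z → z < a → 2 ≤ ∑ i, (R i z + L i z)
      · have h2 := hled.mul_le_travel 2 hl1 hA
        push_cast at h2
        linarith
      by_cases hB : ∀ z, a < z → z < a + w → 2 ≤ ∑ i, (R i z + L i z)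
      · have h2 := hled.mul_le_travel 2 (by linarith) hB
        push_cast at h2
        have h3 := hone (p := a + w) (q := a + y) (by linarith) (by linarith) (by linarith)
        linarith
      push Not at hA hB
      obtain ⟨z, hlz, hza, hz⟩ := hA
      obtain ⟨z', haz, hzw, hz'⟩ := hB
      -- Without leftward crossings of `z`, the agents from `j` on would keep all their energy
      -- beyond `z`. The induction hypothesis excludes this, since `tr ≤ 0` and `(l,z)` costs a
      -- positive amount.
      have hLz : ∃ i, L i z ≠ 0 := by
        by_contra! h0
        have h1 := hled.flux_nonneg z h0
        dsimp only at h1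
        rw [energyFrom_eq_sum_le (hlt hlz) (hle hza.le), sum_tail_succ e hj] at h1
        have h2 := ih z hlz
        have h3 := hone hl0 hlz.le (by linarith)
        linarith
      have hRz := hled.no_right_crossing (j := j) (by linarith) (hlt hlz)
        (hle (m := j + 1) (by linarith)) (by omega) hLz (Nat.lt_succ_iff.1 hz')
      have h1 := hled.flux_nonpos z' hRz
      dsimp only at h1
      have hlt' : ∀ i : Fin k, i.1 < j + 1 → s i < z' := fun i hi => by
        have := station_mono hmono hs (Nat.lt_succ_iff.1 hi)
        rw [station_of_lt s i.2] at this
        linarith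
      rw [energyFrom_eq_sum_le hlt' (hle (by linarith))] at h1
      -- Only the agents after `j` pay beyond `z'`, so the bound is at most `E - (y - w)`; the
      -- assumption on `2 * w` turns this into the claim.
      have h2 : H x ≤ H z' := energyFrom_anti _ _ hres (by linarith)
      have h3 := hone (p := z') (q := a + y) (by linarith) (by linarith) (by linarith)
      linarith
    intro x hx
    clear_value a
    cases ha with
    | deficit htr he =>
      have := ih x (by linarith)
      linarith
    | rightFirst y htr h0 hd hg he hmax =>
      have := balanced y y htr h0 le_rfl hd hg he x hx
      linarith
    | leftFirst y htr hd hg hd3 he hmax =>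
      -- For `w = a - l` the condition on `2 * w` is exactly the threshold `3 * (a - l) ≤ e + tr` of
      -- the procedure.
      have := balanced y (a - l) htr (by linarith) hd le_rfl hg (by linarith) x hx
      linarith
    | surplus y htr h0 hg he hmax =>
      have := ih x (by linarith)
      have h3 := hone (p := a) (q := a + y) hs0 (by linarith) (by linarith)
      linarith

theorem Reach.solvable_of_explores {k : ℕ} {s e : Fin k → ℝ} (hmono : Monotone s)
    (hs : ∀ i, s i ∈ Set.Icc (0 : ℝ) 1) (he : ∀ i, 0 ≤ e i) {l tr : ℝ} (h : Reach s e k l tr)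
    {T : Fin k → Trajectory k} (hvalid : Valid s e T) (hexp : Explores s T) :
    ¬ (l < 1 ∨ tr < 0) := by
  obtain ⟨c', hrun, htodo⟩ := hvalid
  obtain ⟨R, L, W, hled⟩ := exists_ledger hrun
  obtain ⟨hl0, hl1, hl2, -⟩ := h.invariant hmono hs
  rw [station_of_le s le_rfl] at hl1 hl2
  have h1 := h.travel_le hmono hs he hled htodo hexp (l + 1) (by linarith)
  have h2 := energyFrom_nonneg c'.pos c'.energy (hled.energy_nonneg he) (l + 1)
  have h3 : (∑ i : Fin k, if k ≤ i.1 then e i else 0) = 0 :=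
    Finset.sum_eq_zero fun i _ => if_neg (not_le.2 i.2)
  have h4 := hled.mul_le_travel 1 hl1 fun x hx hx' =>
      hled.one_le_crossings htodo hexp (by linarith) (by linarith)
  have h5 := hled.travel_nonneg 1
  rw [Nat.cast_one, one_mul] at h4
  rintro (h6 | h6)
  -- The unexplored part `1 - l` must be paid from `tr`, so `tr > 0`; but a surplus exists only at
  -- `l = 1`.
  · have := hl2 (by linarith)
    linarith
  · linarith

end SegmentExploration

namespace SegmentExploration

/-! ### Sufficiency -/

/-- The agents can pass from `(pos, en)` to `(pos', en')` while visiting `V`. -/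
def Run {k : ℕ} (pos en pos' en' : Fin k → ℝ) (V : Set ℝ) : Prop :=
  ∃ T : Fin k → Trajectory k,
    -- An arbitrary continuation `rest` makes runs composable by concatenating trajectories.
    (∀ rest : Fin k → Trajectory k,
      Relation.ReflTransGen Step ⟨pos, en, fun i => T i ++ rest i⟩ ⟨pos', en', rest⟩) ∧
    ∀ rest : Fin k → Trajectory k,
      V ∪ ⋃ i, visited (pos' i) (rest i) ⊆ ⋃ i, visited (pos i) (T i ++ rest i)

theorem Run.refl {k : ℕ} (pos en : Fin k → ℝ) : Run pos en pos en ∅ :=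
  ⟨fun _ => [], fun _ => Relation.ReflTransGen.refl, fun _ => by simp⟩

theorem Run.trans {k : ℕ} {p₁ e₁ p₂ e₂ p₃ e₃ : Fin k → ℝ} {V V' : Set ℝ}
    (h : Run p₁ e₁ p₂ e₂ V) (h' : Run p₂ e₂ p₃ e₃ V') : Run p₁ e₁ p₃ e₃ (V ∪ V') := by
  obtain ⟨T, h1, h2⟩ := h
  obtain ⟨T', h1', h2'⟩ := h'
  refine ⟨fun i => T i ++ T' i, fun rest => ?_, fun rest => ?_⟩
  · have := (h1 fun i => T' i ++ rest i).trans (h1' rest)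
    simpa only [List.append_assoc] using this
  · have h3 := h2 fun i => T' i ++ rest i
    have h4 := h2' rest
    simp only [List.append_assoc]
    refine subset_trans ?_ h3
    rw [Set.union_assoc]
    exact Set.union_subset_union_right _ h4

theorem Run.move {k : ℕ} (pos en : Fin k → ℝ) (i : Fin k) {q : ℝ} (hq : q ∈ Set.Icc (0 : ℝ) 1)
    (henergy : |q - pos i| ≤ en i) :
    Run pos en (Function.update pos i q) (Function.update en i (en i - |q - pos i|))
      (Set.uIcc (pos i) q) := by
  refine ⟨fun j => if j = i then [Action.move q] else [], fun rest => ?_, fun rest => ?_⟩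
  · refine Relation.ReflTransGen.single ?_
    have h := Step.move (k := k)
      ⟨pos, en, fun j => (if j = i then [Action.move q] else []) ++ rest j⟩ i q (rest i)
      (by simp) hq henergy
    convert h using 2
    funext j
    by_cases hj : j = i
    · subst hj; simp
    · simp [hj]
  · refine Set.union_subset (fun z hz => Set.mem_iUnion.2 ⟨i, ?_⟩)
      (Set.iUnion_subset fun j z hz => Set.mem_iUnion.2 ⟨j, ?_⟩)
    · simpa [visited] using Or.inl hz
    · by_cases hj : j = i
      · subst hj
        simp only [Function.update_self] at hz
        simpa [visited] using Or.inr hz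
      · simpa [hj] using hz

theorem Run.transfer {k : ℕ} (pos en : Fin k → ℝ) {i j : Fin k} (hij : i ≠ j)
    (hmeet : pos i = pos j) {x : ℝ} (hx : 0 ≤ x) (henergy : x ≤ en i) :
    Run pos en pos (Function.update (Function.update en i (en i - x)) j (en j + x)) ∅ := by
  -- A transfer must be positive, so the amount `0` is realised by doing nothing.
  rcases hx.eq_or_lt with rfl | hx
  · simpa using Run.refl pos en
  refine ⟨fun l => if l = i then [Action.give j x] else if l = j then [Action.receive i x] else [],
    fun rest => ?_, fun rest => ?_⟩
  · refine Relation.ReflTransGen.single ?_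
    have h := Step.transfer (k := k) ⟨pos, en, fun l => (if l = i then [Action.give j x] else
      if l = j then [Action.receive i x] else []) ++ rest l⟩ i j x (rest i) (rest j) hij
      (by simp) (by simp [hij.symm]) hmeet hx henergy
    convert h using 2
    funext l
    by_cases hl : l = j
    · subst hl; simp
    · by_cases hl' : l = i
      · subst hl'; simp [hl]
      · simp [hl, hl']
  · refine Set.union_subset (Set.empty_subset _)
      (Set.iUnion_subset fun l z hz => Set.mem_iUnion.2 ⟨l, ?_⟩)
    by_cases hl : l = j
    · subst hl; simpa [hij.symm, visited] using hz
    · by_cases hl' : l = i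
      · subst hl'; simpa [hl, visited] using hz
      · simpa [hl, hl'] using hz

/-- The first `j` agents, being at their initial positions with their initial energies, can explore
`[0,l]` (without `l` if `j = 0`) and give the amount `t` to the agent number `j` waiting at `l`
(or get `-t` from it); no such agent is needed if `t = 0`. -/
def CanServe {k : ℕ} (s e : Fin k → ℝ) (j : ℕ) (l t : ℝ) : Prop :=
  -- Later agents may be anywhere with any energy, so the recursion applies after agent `j` has
  -- moved to `l`.
  ∀ pos en : Fin k → ℝ, (∀ i, i.1 < j → pos i = s i ∧ en i = e i) →
    (t = 0 ∨ ∃ r : Fin k, r.1 = j ∧ pos r = l ∧ 0 ≤ en r + t) →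
    ∃ pos' en' V, Run pos en pos' en' V ∧
      (∀ z, 0 ≤ z → z < l ∨ z = l ∧ 0 < j → z ∈ V) ∧ (∀ i, j ≤ i.1 → pos' i = pos i) ∧
      (∀ i, j < i.1 → en' i = en i) ∧ ∀ i, i.1 = j → en' i = en i + t

theorem Run.exists_move {k : ℕ} (pos en : Fin k → ℝ) (i : Fin k) {q : ℝ}
    (hq : q ∈ Set.Icc (0 : ℝ) 1) (henergy : |q - pos i| ≤ en i) :
    ∃ pos' en', Run pos en pos' en' (Set.uIcc (pos i) q) ∧ pos' i = q ∧
      en' i = en i - |q - pos i| ∧ ∀ r, r ≠ i → pos' r = pos r ∧ en' r = en r :=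
  ⟨_, _, Run.move pos en i hq henergy, by simp, by simp, fun r hr => by simp [hr]⟩

theorem Run.exists_give {k : ℕ} (pos en : Fin k → ℝ) (i : Fin k) {t : ℝ}
    (ht : 0 ≤ t) (henergy : t ≤ en i)
    (hr : t = 0 ∨ ∃ r : Fin k, r.1 = i.1 + 1 ∧ pos r = pos i) :
    ∃ en', Run pos en pos en' ∅ ∧ en' i = en i - t ∧ (∀ r, r.1 < i.1 → en' r = en r) ∧
      (∀ r, r.1 = i.1 + 1 → en' r = en r + t) ∧ ∀ r, i.1 + 1 < r.1 → en' r = en r := by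
  rcases hr with rfl | ⟨r, hr, hpos⟩
  · exact ⟨en, Run.refl _ _, by simp, by simp, by simp, by simp⟩
  have hir : i ≠ r := fun h => by rw [h] at hr; omega
  refine ⟨_, Run.transfer pos en hir hpos.symm ht henergy, ?_, ?_, ?_, ?_⟩
  · simp [hir]
  · intro l hl
    rw [Function.update_of_ne, Function.update_of_ne] <;> (rintro rfl; omega)
  · intro l hl
    obtain rfl : l = r := Fin.ext (by omega)
    simp
  · intro l hl
    rw [Function.update_of_ne, Function.update_of_ne] <;> (rintro rfl; omega)

/-- The successor comes to agent `j` and first gives it the missing amount. Agent `j` then walks to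
`l` and arrives with exactly the debt `-tr`. -/
theorem CanServe.deficit {k : ℕ} {s e : Fin k → ℝ} {j : ℕ} {l tr : ℝ} (h : CanServe s e j l tr)
    (hj : j < k) (hl : l ∈ Set.Icc (0 : ℝ) 1) (hls : l ≤ s ⟨j, hj⟩) (htr : tr ≤ 0)
    (he : e ⟨j, hj⟩ + tr - (s ⟨j, hj⟩ - l) < 0) :
    CanServe s e (j + 1) (s ⟨j, hj⟩) (e ⟨j, hj⟩ + tr - (s ⟨j, hj⟩ - l)) := by
  intro pos en hhome hserve
  obtain ⟨r, hr, hpos, hen⟩ := hserve.resolve_left he.ne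
  set i : Fin k := ⟨j, hj⟩ with hi
  obtain ⟨hpi, hei⟩ := hhome i (Nat.lt_succ_self j)
  have hri : r ≠ i := fun h => by rw [h] at hr; simp [hi] at hr
  have run1 := Run.transfer pos en hri (by rw [hpos, hpi]) (x := -(e i + tr - (s i - l)))
    (by linarith) (by linarith)
  set en1 := Function.update (Function.update en r (en r - -(e i + tr - (s i - l)))) i
    (en i + -(e i + tr - (s i - l))) with hen1
  have h1i : en1 i = s i - l - tr := by
    rw [hen1, Function.update_self, hei]; ring
  have h1r : en1 r = en r + (e i + tr - (s i - l)) := by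
    rw [hen1, Function.update_of_ne hri, Function.update_self]; ring
  have h1 : ∀ m, m ≠ r → m ≠ i → en1 m = en m := fun m hm hm' => by
    rw [hen1, Function.update_of_ne hm', Function.update_of_ne hm]
  have habs : |l - pos i| = s i - l := by rw [hpi, abs_sub_comm, abs_of_nonneg (by linarith)]
  obtain ⟨pos2, en2, run2, h2p, h2e, h2⟩ := Run.exists_move pos en1 i hl (by
    rw [habs]; linarith)
  obtain ⟨pos3, en3, V, run3, hV, h3p, h3e, -⟩ := h pos2 en2 (fun m hm => by
    have hmi : m ≠ i := fun h => by simp [h, hi] at hm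
    have hmr : m ≠ r := fun h => by rw [h] at hm; omega
    rw [(h2 m hmi).1, (h2 m hmi).2, h1 m hmr hmi]
    exact hhome m (by omega)) (Or.inr ⟨i, rfl, h2p, by rw [h2e, habs]; linarith⟩)
  refine ⟨pos3, en3, _, (run1.trans run2).trans run3, ?_, ?_, ?_, ?_⟩
  · intro z hz0 hz
    have hz : z ≤ _ := hz.elim le_of_lt fun h => h.1.le
    rcases lt_or_ge z l with hzl | hzl
    · exact Or.inr (hV z hz0 (Or.inl hzl))
    · refine Or.inl (Or.inr ?_)
      rw [hpi, Set.mem_uIcc]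
      exact Or.inr ⟨hzl, hz⟩
  · intro m hm
    have hmi : m ≠ i := fun h => by simp [h, hi] at hm
    rw [h3p m (by omega), (h2 m hmi).1]
  · intro m hm
    have hmi : m ≠ i := fun h => by simp [h, hi] at hm
    have hmr : m ≠ r := fun h => by rw [h] at hm; omega
    rw [h3e m (by omega), (h2 m hmi).2, h1 m hmr hmi]
  · intro m hm
    obtain rfl : m = r := Fin.ext (by omega)
    rw [h3e m (by omega), (h2 m hri).2, h1r]

/-- Agent `j` hands over `t` at the right end of its walk, keeping enough to return to `l` and pay
the debt there. -/
theorem CanServe.rightFirst {k : ℕ} {s e : Fin k → ℝ} {j : ℕ} {l tr : ℝ} (h : CanServe s e j l tr)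
    (hj : j < k) (hl : l ∈ Set.Icc (0 : ℝ) 1) (hls : l ≤ s ⟨j, hj⟩) (htr : tr ≤ 0) {y t : ℝ}
    (hy : 0 ≤ y) (hy1 : s ⟨j, hj⟩ + y ≤ 1) (ht : 0 ≤ t)
    (he : t ≤ e ⟨j, hj⟩ + tr - (2 * y + (s ⟨j, hj⟩ - l))) :
    CanServe s e (j + 1) (s ⟨j, hj⟩ + y) t := by
  intro pos en hhome hr
  set i : Fin k := ⟨j, hj⟩ with hi
  obtain ⟨hpi, hei⟩ := hhome i (Nat.lt_succ_self j)
  have hsi : 0 ≤ s i := hl.1.trans hls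
  have habs : |s i + y - pos i| = y := by rw [hpi, add_sub_cancel_left, abs_of_nonneg hy]
  obtain ⟨pos1, en1, run1, h1p, h1e, h1⟩ := Run.exists_move pos en i
    (q := s i + y) ⟨by linarith, hy1⟩ (by rw [habs]; linarith)
  obtain ⟨en2, run2, h2i, h2lt, h2eq, h2gt⟩ := Run.exists_give pos1 en1 i ht
    (by rw [h1e, habs]; linarith) (hr.imp_right fun ⟨r, hr, hp, _⟩ => ⟨r, hr, by
      rw [h1p, (h1 r fun h => by simp [h, hi] at hr).1, hp]⟩)
  have habs' : |l - pos1 i| = s i + y - l := by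
    rw [h1p, abs_sub_comm, abs_of_nonneg (by linarith)]
  obtain ⟨pos3, en3, run3, h3p, h3e, h3⟩ := Run.exists_move pos1 en2 i hl (by
    rw [habs', h2i, h1e, habs]; linarith)
  obtain ⟨pos4, en4, V, run4, hV, h4p, h4e, -⟩ := h pos3 en3 (fun m hm => by
    have hmi : m ≠ i := fun h => by simp [h, hi] at hm
    rw [(h3 m hmi).1, (h3 m hmi).2, h2lt m hm, (h1 m hmi).1, (h1 m hmi).2]
    exact hhome m (by omega)) (Or.inr ⟨i, rfl, h3p, by
      rw [h3e, habs', h2i, h1e, habs]; linarith⟩)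
  refine ⟨pos4, en4, _, ((run1.trans run2).trans run3).trans run4, ?_, ?_, ?_, ?_⟩
  · intro z hz0 hz
    have hz : z ≤ _ := hz.elim le_of_lt fun h => h.1.le
    rcases lt_or_ge z l with hzl | hzl
    · exact Or.inr (hV z hz0 (Or.inl hzl))
    · refine Or.inl (Or.inr ?_)
      rw [h1p, Set.mem_uIcc]
      exact Or.inr ⟨hzl, hz⟩
  · intro m hm
    have hmi : m ≠ i := fun h => by simp [h, hi] at hm
    rw [h4p m (by omega), (h3 m hmi).1, (h1 m hmi).1]
  · intro m hm
    have hmi : m ≠ i := fun h => by simp [h, hi] at hm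
    rw [h4e m (by omega), (h3 m hmi).2, h2gt m hm, (h1 m hmi).2]
  · intro m hm
    have hmi : m ≠ i := fun h => by simp [h, hi] at hm
    rw [h4e m (by omega), (h3 m hmi).2, h2eq m hm, (h1 m hmi).2]

/-- The sign of `tr` is free: at `l` agent `j` pays a debt or collects a surplus before turning
right. -/
theorem CanServe.leftFirst {k : ℕ} {s e : Fin k → ℝ} {j : ℕ} {l tr : ℝ} (h : CanServe s e j l tr)
    (hj : j < k) (hl : l ∈ Set.Icc (0 : ℝ) 1) (hls : l ≤ s ⟨j, hj⟩)
    (hd : s ⟨j, hj⟩ - l ≤ e ⟨j, hj⟩) (hd' : s ⟨j, hj⟩ - l ≤ e ⟨j, hj⟩ + tr) {y t : ℝ}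
    (hy : 0 ≤ y) (hy1 : s ⟨j, hj⟩ + y ≤ 1) (ht : 0 ≤ t)
    (he : t ≤ e ⟨j, hj⟩ + tr - (2 * (s ⟨j, hj⟩ - l) + y)) :
    CanServe s e (j + 1) (s ⟨j, hj⟩ + y) t := by
  intro pos en hhome hr
  set i : Fin k := ⟨j, hj⟩ with hi
  obtain ⟨hpi, hei⟩ := hhome i (Nat.lt_succ_self j)
  have hsi : 0 ≤ s i := hl.1.trans hls
  have habs : |l - pos i| = s i - l := by rw [hpi, abs_sub_comm, abs_of_nonneg (by linarith)]
  obtain ⟨pos1, en1, run1, h1p, h1e, h1⟩ := Run.exists_move pos en i hl (by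
    rw [habs, hei]; exact hd)
  obtain ⟨pos2, en2, V, run2, hV, h2p, h2e, h2i⟩ := h pos1 en1 (fun m hm => by
    have hmi : m ≠ i := fun h => by simp [h, hi] at hm
    rw [(h1 m hmi).1, (h1 m hmi).2]
    exact hhome m (by omega)) (Or.inr ⟨i, rfl, h1p, by rw [h1e, habs, hei]; linarith⟩)
  have h2pi : pos2 i = l := by rw [h2p i le_rfl, h1p]
  have h2ei := h2i i rfl
  have habs' : |s i + y - pos2 i| = s i + y - l := by
    rw [h2pi, abs_of_nonneg (by linarith)]
  obtain ⟨pos3, en3, run3, h3p, h3e, h3⟩ := Run.exists_move pos2 en2 i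
    (q := s i + y) ⟨by linarith, hy1⟩ (by rw [habs', h2ei, h1e, habs]; linarith)
  obtain ⟨en4, run4, h4i, h4lt, h4eq, h4gt⟩ := Run.exists_give pos3 en3 i ht
    (by rw [h3e, habs', h2ei, h1e, habs]; linarith) (hr.imp_right fun ⟨r, hr, hp, _⟩ => ⟨r, hr, by
      have hri : r ≠ i := fun h => by simp [h, hi] at hr
      rw [h3p, (h3 r hri).1, h2p r (by omega), (h1 r hri).1, hp]⟩)
  refine ⟨pos3, en4, _, ((run1.trans run2).trans run3).trans run4, ?_, ?_, ?_, ?_⟩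
  · intro z hz0 hz
    have hz : z ≤ _ := hz.elim le_of_lt fun h => h.1.le
    rcases lt_or_ge z l with hzl | hzl
    · exact Or.inl (Or.inl (Or.inr (hV z hz0 (Or.inl hzl))))
    · refine Or.inl (Or.inr ?_)
      rw [h2pi, Set.mem_uIcc]
      exact Or.inl ⟨hzl, hz⟩
  · intro m hm
    have hmi : m ≠ i := fun h => by simp [h, hi] at hm
    rw [(h3 m hmi).1, h2p m (by omega), (h1 m hmi).1]
  · intro m hm
    have hmi : m ≠ i := fun h => by simp [h, hi] at hm
    rw [h4gt m hm, (h3 m hmi).2, h2e m (by omega), (h1 m hmi).2]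
  · intro m hm
    have hmi : m ≠ i := fun h => by simp [h, hi] at hm
    rw [h4eq m hm, (h3 m hmi).2, h2e m (by omega), (h1 m hmi).2]

theorem CanServe.zero {k : ℕ} (s e : Fin k → ℝ) : CanServe s e 0 0 0 := fun pos en _ _ =>
  ⟨pos, en, ∅, Run.refl _ _, fun z h0 h => by rcases h with h | h <;> grind, by simp, by simp,
    by simp⟩

/-- The alternative `t = 0` lets a surplus be discarded, which is needed after the last agent, where
there is no receiver. -/
theorem Reach.canServe {k : ℕ} {s e : Fin k → ℝ} (hmono : Monotone s)
    (hs : ∀ i, s i ∈ Set.Icc (0 : ℝ) 1) (he : ∀ i, 0 ≤ e i) {j : ℕ} {l tr : ℝ}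
    (h : Reach s e j l tr) :
    ∀ t, t = tr ∨ t = 0 ∧ 0 ≤ tr → CanServe s e j l t := by
  induction h with
  | zero =>
    intro t ht
    obtain rfl : t = 0 := by grind
    exact CanServe.zero s e
  | @succ j l tr l' tr' h hj ha ih =>
    intro t ht
    obtain ⟨hl0, hl1, hl2, -⟩ := h.invariant hmono hs
    have ih := ih tr (Or.inl rfl)
    have hs1 := (station_mem hs (j + 1)).2
    have hei := he ⟨j, hj⟩
    have hl : l ∈ Set.Icc (0 : ℝ) 1 := ⟨hl0, hl1.trans (station_mem hs j).2⟩
    rw [station_of_lt s hj] at hl1 hl2 ha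
    cases ha with
    | deficit htr hlt =>
      obtain rfl : t = _ := ht.resolve_right fun h => by linarith [h.2]
      exact ih.deficit hj hl hl1 htr (by linarith)
    | rightFirst y htr h0 hd hg hy hmax =>
      exact ih.rightFirst hj hl hl1 htr h0 (by linarith)
        (by rcases ht with rfl | ⟨rfl, _⟩ <;> linarith)
        (by rcases ht with rfl | ⟨rfl, _⟩ <;> linarith)
    | leftFirst y htr hd hg hd3 hy hmax =>
      exact ih.leftFirst hj hl hl1 (by linarith) (by linarith) (by linarith) (by linarith)
        (by rcases ht with rfl | ⟨rfl, _⟩ <;> linarith)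
        (by rcases ht with rfl | ⟨rfl, _⟩ <;> linarith)
    | surplus y htr h0 hg hy hmax =>
      have := hl2 htr
      -- A surplus means that `l` is the position of agent `j`, so this is a left-first walk with an
      -- empty left part.
      exact ih.leftFirst hj hl hl1 (by linarith) (by linarith) h0 (by linarith)
        (by rcases ht with rfl | ⟨rfl, _⟩ <;> linarith)
        (by rcases ht with rfl | ⟨rfl, _⟩ <;> linarith)

theorem Reach.exists_explores {k : ℕ} (hk : 1 ≤ k) {s e : Fin k → ℝ} (hmono : Monotone s)
    (hs : ∀ i, s i ∈ Set.Icc (0 : ℝ) 1) (he : ∀ i, 0 ≤ e i) {l tr : ℝ} (h : Reach s e k l tr)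
    (hl : 1 ≤ l) (htr : 0 ≤ tr) :
    ∃ T : Fin k → Trajectory k, Valid s e T ∧ Explores s T := by
  obtain ⟨pos', en', V, ⟨T, h1, h2⟩, hV, -⟩ := h.canServe hmono hs he 0 (Or.inr ⟨rfl, htr⟩) s e
    (fun i _ => ⟨rfl, rfl⟩) (Or.inl rfl)
  have h1 := h1 fun _ => []
  have h2 := h2 fun _ => []
  simp only [List.append_nil] at h1 h2
  refine ⟨T, ⟨_, h1, fun _ => rfl⟩, fun z hz => h2 (Or.inl (hV z hz.1 ?_))⟩
  rcases (hz.2.trans hl).lt_or_eq with h | h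
  · exact Or.inl h
  · exact Or.inr ⟨h, hk⟩

end SegmentExploration

namespace SegmentExploration

/-! ### Execution of the procedure -/

/-- Commands contain no loops, so the bound depends on the syntax alone. -/
theorem Cmd.exists_time_le (c : Cmd) :
    ∃ C : ℕ, ∀ (k : ℕ) (I : Input k) (i : ℕ) (σ : Var → ℝ), (c.exec I i σ).2 ≤ C := by
  induction c with
  | assign v a => exact ⟨_, fun k I i σ => le_rfl⟩
  | seq c₁ c₂ ih₁ ih₂ =>
    obtain ⟨C₁, h₁⟩ := ih₁
    obtain ⟨C₂, h₂⟩ := ih₂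
    refine ⟨C₁ + C₂, fun k I i σ => ?_⟩
    have h := h₁ k I i σ
    rw [Cmd.exec]
    rcases hc : c₁.exec I i σ with ⟨o, t⟩
    rw [hc] at h
    cases o with
    | next σ' => exact add_le_add h (h₂ k I i σ')
    | call a b => exact h.trans (Nat.le_add_right _ _)
    | ret r => exact h.trans (Nat.le_add_right _ _)
  | ite p c₁ c₂ ih₁ ih₂ =>
    obtain ⟨C₁, h₁⟩ := ih₁
    obtain ⟨C₂, h₂⟩ := ih₂
    refine ⟨p.time + 1 + (C₁ + C₂), fun k I i σ => ?_⟩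
    have h := h₁ k I i σ
    have h' := h₂ k I i σ
    rw [Cmd.exec]
    split_ifs <;> dsimp only <;> omega
  | call a b => exact ⟨_, fun k I i σ => le_rfl⟩
  | ret r => exact ⟨_, fun k I i σ => le_rfl⟩

theorem exec_pathBody {k : ℕ} (I : Input k) (i : ℕ) (l tr : ℝ)
    (hpos : entry I.pos i ≤ entry I.pos (i + 1)) (hen : 0 ≤ entry I.energy i) :
    ∃ l' tr', Advance (entry I.energy i) (entry I.pos i) (entry I.pos (i + 1)) l tr l' tr' ∧
      (i < k → (pathBody.exec I i (initStore l tr)).1 = .call l' tr') ∧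
      (¬ i < k → ∃ r, (pathBody.exec I i (initStore l tr)).1 = .ret r ∧
        (r = true ↔ ¬ (l' < 1 ∨ tr' < 0))) := by
  have tail : ∀ l' tr' : ℝ, ∀ o : Outcome,
      (o = if i < k then .call l' tr' else if l' < 1 ∨ tr' < 0 then .ret false else .ret true) →
      (i < k → o = .call l' tr') ∧
      (¬ i < k → ∃ r, o = .ret r ∧ (r = true ↔ ¬ (l' < 1 ∨ tr' < 0))) := by
    intro l' tr' o ho
    subst ho
    refine ⟨fun h => if_pos h, fun h => ?_⟩
    rw [if_neg h]
    split_ifs with h'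
    · exact ⟨false, rfl, by simp [h']⟩
    · exact ⟨true, rfl, by simp [h']⟩
  by_cases h1 : tr ≤ 0
  · by_cases h2 : entry I.energy i < entry I.pos i - l - tr
    · refine ⟨_, _, .deficit h1 h2, tail _ _ _ ?_⟩
      simp [pathBody, Cmd.exec, Test.Holds, RealExpr.eval, initStore, h1, h2, deficitCase]
      split_ifs <;> rfl
    · by_cases h3 : entry I.energy i + tr ≤ 3 * (entry I.pos i - l)
      · refine ⟨_, _, .rightFirst (min ((entry I.energy i + tr - (entry I.pos i - l)) / 2)
          (entry I.pos (i + 1) - entry I.pos i)) h1 ?_ ?_ ?_ ?_ ?_, tail _ _ _ ?_⟩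
        · exact le_min (by linarith) (by linarith)
        -- This is where `e' ≤ 3 * d` enters: it gives `(e' - d) / 2 ≤ d`.
        · exact (min_le_left _ _).trans (by linarith)
        · exact min_le_right _ _
        · linarith [min_le_left ((entry I.energy i + tr - (entry I.pos i - l)) / 2)
            (entry I.pos (i + 1) - entry I.pos i)]
        · rcases min_choice ((entry I.energy i + tr - (entry I.pos i - l)) / 2)
            (entry I.pos (i + 1) - entry I.pos i) with h | h <;> rw [h]
          · exact Or.inr (by ring)
          · exact Or.inl rfl
        · simp [pathBody, Cmd.exec, Test.Holds, RealExpr.eval, initStore, h1, h2, h3, balancedCase]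
          split_ifs <;> rfl
      · by_cases h4 : entry I.pos (i + 1) - entry I.pos i ≤ entry I.pos i - l
        · refine ⟨_, _, .rightFirst (entry I.pos (i + 1) - entry I.pos i) h1 (by linarith) h4 le_rfl
            (by linarith) (Or.inl rfl), tail _ _ _ ?_⟩
          simp [pathBody, Cmd.exec, Test.Holds, RealExpr.eval, initStore, h1, h2, h3, h4,
            balancedCase]
          split_ifs <;> rfl
        · refine ⟨_, _, .leftFirst (min (entry I.energy i + tr - 2 * (entry I.pos i - l))
            (entry I.pos (i + 1) - entry I.pos i)) h1 ?_ ?_ ?_ ?_ ?_, tail _ _ _ ?_⟩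
          · exact le_min (by linarith) (by linarith)
          · exact min_le_right _ _
          · linarith
          · exact min_le_left _ _
          · exact (min_choice _ _).symm
          · simp [pathBody, Cmd.exec, Test.Holds, RealExpr.eval, initStore, h1, h2, h3, h4,
              balancedCase]
            split_ifs <;> rfl
  · refine ⟨_, _, .surplus (min (entry I.pos (i + 1) - entry I.pos i) (entry I.energy i + tr))
      (not_le.1 h1) ?_ ?_ ?_ ?_, tail _ _ _ ?_⟩
    · exact le_min (by linarith) (by linarith)
    · exact min_le_left _ _
    · exact min_le_right _ _
    · exact min_choice _ _
    · simp [pathBody, Cmd.exec, Test.Holds, RealExpr.eval, initStore, h1, surplusCase]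
      split_ifs <;> rfl

theorem entry_withDummy_energy {k : ℕ} (s e : Fin k → ℝ) {j : ℕ} (hj : j < k) :
    entry (withDummy s e).energy (j + 1) = e ⟨j, hj⟩ := by
  rw [entry, dif_pos ⟨by omega, by omega⟩]
  exact Fin.snoc_castSucc (α := fun _ => ℝ) 0 e ⟨j, hj⟩

theorem entry_withDummy_pos {k : ℕ} (s e : Fin k → ℝ) {j : ℕ} (hj : j ≤ k) :
    entry (withDummy s e).pos (j + 1) = station s j := by
  rw [entry, dif_pos ⟨by omega, by omega⟩]
  rcases hj.lt_or_eq with h | rfl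
  · rw [station_of_lt s h]
    exact Fin.snoc_castSucc (α := fun _ => ℝ) 1 s ⟨j, h⟩
  · rw [station_of_le s le_rfl]
    exact Fin.snoc_last (α := fun _ => ℝ) 1 s

/-- Induction on the number `m` of calls still to be made. `Reach` counts agents from `0` and the
procedure from `1`, hence the index `j + 1`. -/
theorem Reach.exists_returns {C : ℕ}
    (hC : ∀ (k : ℕ) (I : Input k) (i : ℕ) (σ : Var → ℝ), (pathBody.exec I i σ).2 ≤ C)
    {k : ℕ} {s e : Fin k → ℝ} (hmono : Monotone s) (hs : ∀ i, s i ∈ Set.Icc (0 : ℝ) 1)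
    (he : ∀ i, 0 ≤ e i) (m : ℕ) : ∀ {j : ℕ} {l tr : ℝ}, Reach s e j l tr → j + m + 1 = k →
    ∃ r t, Returns pathBody (withDummy s e) (j + 1) l tr r t ∧ t ≤ C * (m + 1) ∧
      ∃ l' tr', Reach s e k l' tr' ∧ (r = true ↔ ¬ (l' < 1 ∨ tr' < 0)) := by
  induction m with
  | zero =>
    intro j l tr h hjk
    have hj : j < k := by omega
    have hC := hC k (withDummy s e) (j + 1) (initStore l tr)
    obtain ⟨l', tr', ha, -, hret⟩ := exec_pathBody (withDummy s e) (j + 1) l tr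
      (by rw [entry_withDummy_pos s e hj.le, entry_withDummy_pos s e hj]
          exact station_mono hmono hs (Nat.le_succ j))
      (by rw [entry_withDummy_energy s e hj]; exact he _)
    rw [entry_withDummy_pos s e hj.le, entry_withDummy_pos s e hj,
      entry_withDummy_energy s e hj] at ha
    obtain ⟨r, hr, hiff⟩ := hret (by omega)
    have hreach := h.succ hj ha
    rw [show j + 1 = k by omega] at hreach
    exact ⟨r, _, .ret _ _ _ _ _ (Prod.ext hr rfl), by simpa using hC, l', tr', hreach, hiff⟩
  | succ m ih =>
    intro j l tr h hjk
    have hj : j < k := by omega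
    have hC := hC k (withDummy s e) (j + 1) (initStore l tr)
    obtain ⟨l', tr', ha, hcall, -⟩ := exec_pathBody (withDummy s e) (j + 1) l tr
      (by rw [entry_withDummy_pos s e hj.le, entry_withDummy_pos s e hj]
          exact station_mono hmono hs (Nat.le_succ j))
      (by rw [entry_withDummy_energy s e hj]; exact he _)
    rw [entry_withDummy_pos s e hj.le, entry_withDummy_pos s e hj,
      entry_withDummy_energy s e hj] at ha
    obtain ⟨r, t, hret, ht, hfin⟩ := ih (h.succ hj ha) (by omega)
    refine ⟨r, _, .call _ _ _ _ _ _ _ _ (Prod.ext (hcall (by omega)) rfl) hret, ?_, hfin⟩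
    exact (add_le_add hC ht).trans_eq (by ring)

end SegmentExploration

theorem mainTheorem1 :
    ∃ C : ℕ, ∀ (k : ℕ), 1 ≤ k → ∀ (s e : Fin k → ℝ),
      Monotone s → (∀ i, s i ∈ Set.Icc (0 : ℝ) 1) → (∀ i, 0 ≤ e i) →
      ∃ (solvable : Bool) (t : ℕ),
        SegmentExploration.Returns SegmentExploration.pathBody
          (SegmentExploration.withDummy s e) 1 0 0 solvable t ∧
        t ≤ C * k ∧
        (solvable = true ↔
          ∃ T : Fin k → SegmentExploration.Trajectory k,
            SegmentExploration.Valid s e T ∧ SegmentExploration.Explores s T) := by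
  obtain ⟨C, hC⟩ := SegmentExploration.pathBody.exists_time_le
  refine ⟨C, fun k hk s e hmono hs he => ?_⟩
  obtain ⟨r, t, hret, ht, l, tr, hreach, hiff⟩ :=
    SegmentExploration.Reach.exists_returns hC hmono hs he (k - 1) .zero (by omega)
  rw [show k - 1 + 1 = k by omega] at ht
  refine ⟨r, t, hret, ht, hiff.trans ⟨fun h => ?_, fun ⟨T, hv, hx⟩ => ?_⟩⟩
  · push Not at h
    exact hreach.exists_explores hk hmono hs he h.1 h.2
  · exact hreach.solvable_of_explores hmono hs he hv hx
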